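/- Let $n,m\ge 1$, let $A\in\mathbb{R}_+^{m\times n}$, $b\in\mathbb{R}_+^m$, $c^0,d\in\mathbb{R}_+^n$, and let $$\mathcal{C}=\{c^0+u : u\in\mathbb{R}^n_+,\ u\le d,\ Au\le b\}.$$ For a nonempty set $S\subseteq\{0,1\}^n$ put $\mathrm{OPT}_R=\min_{x\in S}\max_{c\in\mathcal{C}}c^Tx$. A vector $\hat x\in S$ is *$\rho$-deterministically robust* if $c^T\hat x\le\rho\cdot\mathrm{OPT}_R$ for all $c\in\mathcal{C}$. Let $Q\supseteq S$ be a polyhedron in $\mathbb{R}^n_+$ (an LP relaxation of $S$). An *$\alpha$-integrality gap verifier* ($\alpha\ge1$) is a procedure that, given $c\in\mathbb{R}_+^n$ and $x\in Q$, returns $\hat x\in S$ with $c^T\hat x\le\alpha\, c^Tx$. An *$\alpha$-approximation algorithm* for the nominal problem is a procedure that, given $c\in\mathbb{R}^n_+$, returns $\hat x\in S$ with $c^T\hat x\le\alpha\min_{x\in S}c^Tx$. Call a column $j$ *active* if $d_j>0$ and $a_{ij}=0$ for every $i$ with $b_i=0$ (for all other $j$, $u_j=0$ is forced; if $b>0$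 and $d>0$ then all columns are active). For $\epsilon>0$ define $$L=L(A,c^0,d)=n\cdot\max\left\{\frac{\max_jc^0_j}{\min_jc^0_j},\ \frac{m+n}{\epsilon}\max\left\{\frac{\max_{i,j}a_{ij}/b_i}{\min_j\max_ia_{ij}/b_i},\ \frac{\max_jd_j}{\min_jd_j}\right\}\right\},$$ where in the inner maximum $j$ runs over the active columns and $i$ over the rows with $b_i>0$. Say that $L$ is *well defined* if there is an active column, $c^0_j>0$ for all $j$, and every active column of $A$ is nonzero. **Theorem.** There is a universal constant $K>0$ such that the following holds for all $n,m\ge1$. There is a deterministic oracle algorithm that, given $A,b,c^0,d$ and $0<\epsilon\le1$, and given access to $S$ and $Q$ only through an $\alpha$-integrality gap verifier and a solver for the linear programs $\min\{c^Tx:x\in Q\}$, $c\in\mathbb{R}^n_+$, outputs, after finitely many calls, an $\alpha(1+K\epsilon)$-deterministically robust solution, for every $\alpha\ge1$, every nonempty $S\subseteq\{0,1\}^n$ and every LP relaxation $Q$ of $S$. Whenever $L$ is well defined, the number of calls to the verifier is at most $$K\cdot\frac{\log L}{\epsilon}\cdot\left(\log_{1+\epsilon}\frac{(1+\epsilon)m}{\epsilon}\right)^m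 ,$$ and so is the number of linear programs solved. In particular, for every fixed $m$ these numbers are bounded by a polynomial in $\log L$ and $1/\epsilon$. The same holds with any $\alpha$-approximation algorithm for the nominal problem in place of the verifier and the LP solver. -/

import Mathlib

/-! ### Discrete minimization problems, LP relaxations, black boxes -/

/-- Vectors of `ℝⁿ`, ordered componentwise. -/
abbrev Vec (n : ℕ) : Type := Fin n → ℝ

/-- `S ⊆ {0,1}ⁿ`. -/
def IsBinary {n : ℕ} (S : Set (Vec n)) : Prop :=
  ∀ x ∈ S, ∀ j, x j = 0 ∨ x j = 1

/-- `Q ⊆ ℝⁿ₊` is (the feasible region of) a linear programming relaxation of `S`: it is given by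
finitely many linear inequalities together with `x ≥ 0`, and it contains `S`. -/
def IsLPRelaxation {n : ℕ} (S Q : Set (Vec n)) : Prop :=
  (∃ (k : ℕ) (M : Matrix (Fin k) (Fin n) ℝ) (h : Vec k),
    Q = {x : Vec n | 0 ≤ x ∧ h ≤ M.mulVec x}) ∧ S ⊆ Q

/-- `lp` solves the linear programs `min {cᵀx : x ∈ Q}`, `c ∈ ℝⁿ₊`. -/
def IsLPSolver {n : ℕ} (Q : Set (Vec n)) (lp : Vec n → Vec n) : Prop :=
  ∀ c : Vec n, 0 ≤ c → lp c ∈ Q ∧ ∀ y ∈ Q, c ⬝ᵥ lp c ≤ c ⬝ᵥ y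

/-- `ver` is an `α`-integrality gap verifier for the pair `S`, `Q` (w.r.t. the class `ℝⁿ₊` of
objectives): given `c ∈ ℝⁿ₊` and `x ∈ Q` it returns `x̂ ∈ S` with `cᵀx̂ ≤ α cᵀx`.
Nothing is required on other inputs. -/
def IsGapVerifier {n : ℕ} (α : ℝ) (S Q : Set (Vec n)) (ver : Vec n → Vec n → Vec n) : Prop :=
  ∀ c x : Vec n, 0 ≤ c → x ∈ Q → ver c x ∈ S ∧ c ⬝ᵥ ver c x ≤ α * (c ⬝ᵥ x)

/-- `apx` is an `α`-approximation algorithm for the nominal problem `min {cᵀx : x ∈ S}`,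
`c ∈ ℝⁿ₊`. -/
def IsApproxAlgorithm {n : ℕ} (α : ℝ) (S : Set (Vec n)) (apx : Vec n → Vec n) : Prop :=
  ∀ c : Vec n, 0 ≤ c → apx c ∈ S ∧ ∀ y ∈ S, c ⬝ᵥ apx c ≤ α * (c ⬝ᵥ y)

/-! ### Robust problems -/

/-- The worst-case cost `max_{c ∈ 𝒞} cᵀx`. -/
noncomputable def worstCost {n : ℕ} (U : Set (Vec n)) (x : Vec n) : ℝ :=
  sSup ((fun c : Vec n => c ⬝ᵥ x) '' U)

/-- The robust optimum `OPT_R = min_{x ∈ S} max_{c ∈ 𝒞} cᵀx`. -/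
noncomputable def robustOpt {n : ℕ} (S U : Set (Vec n)) : ℝ :=
  sInf (worstCost U '' S)

/-- `x̂` is a `ρ`-deterministically robust solution: `x̂ ∈ S` and `cᵀx̂ ≤ ρ · OPT_R` for every
`c ∈ 𝒞`. -/
def IsDeterministicallyRobust {n : ℕ} (ρ : ℝ) (S U : Set (Vec n)) (x : Vec n) : Prop :=
  x ∈ S ∧ ∀ c ∈ U, c ⬝ᵥ x ≤ ρ * robustOpt S U

/-! ### Polyhedral uncertainty -/

/-- The data `A ∈ ℝ₊^{m×n}`, `b ∈ ℝ₊^m`, `c⁰, d ∈ ℝ₊ⁿ`. -/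
structure PolyData (n m : ℕ) where
  A : Matrix (Fin m) (Fin n) ℝ
  b : Vec m
  c0 : Vec n
  d : Vec n
  A_nonneg : ∀ i j, 0 ≤ A i j
  b_nonneg : 0 ≤ b
  c0_nonneg : 0 ≤ c0
  d_nonneg : 0 ≤ d

namespace PolyData

variable {n m : ℕ}

/-- `𝒞 = {c⁰ + u : 0 ≤ u ≤ d, A u ≤ b}`. -/
def uncertainty (I : PolyData n m) : Set (Vec n) :=
  {c | ∃ u : Vec n, 0 ≤ u ∧ u ≤ I.d ∧ I.A.mulVec u ≤ I.b ∧ c = I.c0 + u}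

/-- The columns that are not trivially fixed. If `d_j = 0`, or if `b_i = 0 < a_ij` for some `i`,
then `u_j = 0` throughout the uncertainty set, and the variable `u_j` is left out.
If `b > 0` and `d > 0`, every column is active. -/
def Active (I : PolyData n m) (j : Fin n) : Prop :=
  0 < I.d j ∧ ∀ i, I.b i = 0 → I.A i j = 0

/-- `max_i a_ij / b_i`. For an active column, a row with `b_i = 0` has `a_ij = 0`, is void, and
contributes `0`. -/
noncomputable def colMax (I : PolyData n m) (j : Fin n) : ℝ :=
  ⨆ i : Fin m, I.A i j / I.b i

/-- The quantity
`L(A,c⁰,d) = n · max { max_j c⁰_j / min_j c⁰_j,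
  (m+n)/ε · max { max_{i,j} (a_ij/b_i) / min_j max_i (a_ij/b_i), max_j d_j / min_j d_j } }`,
where the maxima and minima in the inner `max` run over the active columns. -/
noncomputable def L (I : PolyData n m) (ε : ℝ) : ℝ :=
  n * max ((⨆ j : Fin n, I.c0 j) / (⨅ j : Fin n, I.c0 j))
    (((m + n : ℕ) : ℝ) / ε *
      max ((⨆ j : {j // I.Active j}, I.colMax j) / (⨅ j : {j // I.Active j}, I.colMax j))
        ((⨆ j : {j // I.Active j}, I.d j) / (⨅ j : {j // I.Active j}, I.d j)))

/-- `L(A,c⁰,d)` is a well-defined finite number: there is an active column, and no denominator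
in it vanishes. -/
def LDefined (I : PolyData n m) : Prop :=
  (∀ j, 0 < I.c0 j) ∧ (∃ j, I.Active j) ∧ ∀ j, I.Active j → ∃ i, 0 < I.A i j

end PolyData

/-- `(log L(A,c⁰,d) / ε) · (log_{1+ε} ((1+ε)m/ε))^m`. -/
noncomputable def callBound {n m : ℕ} (I : PolyData n m) (ε : ℝ) : ℝ :=
  Real.log (I.L ε) / ε * Real.logb (1 + ε) ((1 + ε) * m / ε) ^ m

/-! ### Algorithms with black-box access -/

/-- A deterministic adaptive algorithm with oracle access: it either stops with an output, or asks
a query and continues depending on the answer. It sees the oracle only through the answers. -/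
inductive OracleAlg (Query Answer Output : Type) : Type
  | output (o : Output) : OracleAlg Query Answer Output
  | ask (q : Query) (next : Answer → OracleAlg Query Answer Output) :
      OracleAlg Query Answer Output

namespace OracleAlg

variable {Query Answer Output : Type}

/-- The output of the algorithm when the queries are answered by `O`. -/
def run (O : Query → Answer) : OracleAlg Query Answer Output → Output
  | output o => o
  | ask q next => run O (next (O q))

/-- The queries asked, in order, when they are answered by `O`. -/
def queries (O : Query → Answer) : OracleAlg Query Answer Output → List Query
  | output _ => []
  | ask q next => q :: queries O (next (O q))

end OracleAlg

/-- The two kinds of queries of an algorithm based on an integrality gap verifier: solve the LP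
relaxation for the objective `c`, or call the verifier on `(c, x)`. -/
inductive GapQuery (n : ℕ) : Type
  | solveLP (c : Vec n) : GapQuery n
  | verify (c x : Vec n) : GapQuery n

namespace GapQuery

/-- Answer the queries by an LP solver and a verifier. -/
def answer {n : ℕ} (lp : Vec n → Vec n) (ver : Vec n → Vec n → Vec n) : GapQuery n → Vec n
  | solveLP c => lp c
  | verify c x => ver c x

/-- Is the query a call to the verifier? -/
def isVerify {n : ℕ} : GapQuery n → Bool
  | solveLP _ => false
  | verify _ _ => true

end GapQuery

/-- Algorithms with access to an LP solver for the relaxation and to an integrality gap verifier. -/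
abbrev GapAlg (n : ℕ) : Type := OracleAlg (GapQuery n) (Vec n) (Vec n)

namespace GapAlg

/-- The output of the algorithm. -/
def result {n : ℕ} (P : GapAlg n) (lp : Vec n → Vec n) (ver : Vec n → Vec n → Vec n) : Vec n :=
  OracleAlg.run (GapQuery.answer lp ver) P

/-- The number of calls to the verifier. -/
def verifierCalls {n : ℕ} (P : GapAlg n) (lp : Vec n → Vec n) (ver : Vec n → Vec n → Vec n) : ℕ :=
  (OracleAlg.queries (GapQuery.answer lp ver) P).countP GapQuery.isVerify

/-- The number of calls to the LP solver. -/
def lpCalls {n : ℕ} (P : GapAlg n) (lp : Vec n → Vec n) (ver : Vec n → Vec n → Vec n) : ℕ :=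
  (OracleAlg.queries (GapQuery.answer lp ver) P).countP (fun q => !q.isVerify)

end GapAlg

/-- Algorithms with access to an approximation algorithm for the nominal problem; a query is an
objective vector. -/
abbrev ApxAlg (n : ℕ) : Type := OracleAlg (Vec n) (Vec n) (Vec n)

namespace ApxAlg

/-- The output of the algorithm. -/
def result {n : ℕ} (P : ApxAlg n) (apx : Vec n → Vec n) : Vec n :=
  OracleAlg.run apx P

/-- The number of calls to the approximation algorithm. -/
def calls {n : ℕ} (P : ApxAlg n) (apx : Vec n → Vec n) : ℕ :=
  (OracleAlg.queries apx P).length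

end ApxAlg

/-- The number `N` of calls is `O(callBound)` with the constant `K` and, for fixed `m`, at most a
polynomial in `log L` and `1/ε` with coefficient `C m` and degree `p m`. -/
def WithinCallBound {n m : ℕ} (K : ℝ) (C p : ℕ → ℕ) (I : PolyData n m) (ε : ℝ) (N : ℕ) : Prop :=
  (N : ℝ) ≤ K * callBound I ε ∧
    (N : ℝ) ≤ C m * (Real.log (I.L ε) + 1 / ε) ^ p m

/-! ### Lagrangian duality -/

/-! For fixed binary x the adversary solves a linear program in u. Dualizing only the m rows leaves
min over p ≥ 0 of ∑ p_i + c⁰ᵀx + ∑_j d_j max(0, x_j − ∑_i (a_ij/b_i) p_i). As x_j ∈ {0,1}, the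
truncated term equals x_j · max(0, 1 − ∑_i (a_ij/b_i) p_i), so for fixed p the bound is a constant
plus a nonnegative linear objective in x: a nominal problem. Hence OPT_R is the minimum over p of
nominal optima, and it suffices to try finitely many p and keep the best bound.

Rounding p up never increases the objective (`objective_anti`), so only the growth of ∑ p_i costs
anything. A grid geometric in the total and in each coordinate gives a factor 1 + O(ε) plus an
additive ε · lo (`exists_grid_ge`). The additive term is harmless because the dual value is at least
lo once x uses a column on which p acts (`le_dualValue`). Comparing an optimal p with p = 0 or with
a constant multiplier bounds ∑ p_i, hence the number of levels. `exists_mem_grid_dualValue_le`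
combines these facts; `isDeterministicallyRobust_search` passes from the multipliers to the oracle.

A verifier applied to an LP optimum is an approximation algorithm, so one search serves both models.
-/

lemma le_of_forall_pos_add_mul_lt {a b c : ℝ} (h : ∀ δ : ℝ, 0 < δ → a + δ * b < c) : a ≤ c := by
  refine le_of_forall_pos_le_add fun e he => ?_
  have hb : 0 < |b| + 1 := by positivity
  have h1 := h (e / (|b| + 1)) (by positivity)
  have h2 : -e ≤ e / (|b| + 1) * b := by
    rw [div_mul_eq_mul_div, le_div_iff₀ hb]
    nlinarith [neg_abs_le b]
  linarith

lemma nonpos_of_forall_pos_mul_lt {a c : ℝ} (h : ∀ t : ℝ, 0 < t → t * a < c) : a ≤ 0 := by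
  by_contra! ha
  have := h ((|c| + 1) / a) (by positivity)
  rw [div_mul_cancel₀ _ ha.ne'] at this
  linarith [le_abs_self c]

/-- A Lagrange multiplier for the linear program `max {uᵀx : 0 ≤ u ≤ d, w u ≤ 1}`. -/
lemma exists_multiplier {m n : ℕ} (w : Fin m → Fin n → ℝ) (d x : Vec n) (hd : 0 ≤ d) (V : ℝ)
    (hV : ∀ u : Vec n, 0 ≤ u → u ≤ d → (∀ i, ∑ j, w i j * u j ≤ 1) → u ⬝ᵥ x ≤ V) :
    ∃ p : Vec m, 0 ≤ p ∧ ∀ u : Vec n, 0 ≤ u → u ≤ d →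
      u ⬝ᵥ x + ∑ i, p i * (1 - ∑ j, w i j * u j) ≤ V := by
  -- Resource levels and values that some u in the box strictly beats. Strictness makes this convex
  -- set open, so it can be separated from the point (0, V), which it misses.
  let C : Set (Vec m × ℝ) := {z | ∃ u : Vec n, 0 ≤ u ∧ u ≤ d ∧
    (∀ i, ∑ j, w i j * u j - 1 < z.1 i) ∧ z.2 < u ⬝ᵥ x}
  have hC : Convex ℝ C := by
    rintro ⟨s, t⟩ ⟨u, hu0, hud, hus, hut⟩ ⟨s', t'⟩ ⟨u', hu0', hud', hus', hut'⟩ a b ha hb hab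
    have key : ∀ y z y' z' : ℝ, y < z → y' < z' → a * y + b * y' < a * z + b * z' := by
      intro y z y' z' h h'
      rcases ha.eq_or_lt with rfl | ha
      · obtain rfl : b = 1 := by linarith
        linarith
      · nlinarith [mul_lt_mul_of_pos_left h ha, mul_le_mul_of_nonneg_left h'.le hb]
    refine ⟨a • u + b • u', ?_, ?_, fun i => ?_, ?_⟩
    · exact add_nonneg (smul_nonneg ha hu0) (smul_nonneg hb hu0')
    · calc a • u + b • u' ≤ a • d + b • d :=
          add_le_add (smul_le_smul_of_nonneg_left hud ha) (smul_le_smul_of_nonneg_left hud' hb)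
        _ = d := by rw [← add_smul, hab, one_smul]
    · have h1 : ∑ j, w i j * (a • u + b • u') j - 1
          = a * (∑ j, w i j * u j - 1) + b * (∑ j, w i j * u' j - 1) := by
        have : ∑ j, w i j * (a • u + b • u') j
            = a * ∑ j, w i j * u j + b * ∑ j, w i j * u' j := by
          rw [Finset.mul_sum, Finset.mul_sum, ← Finset.sum_add_distrib]
          refine Finset.sum_congr rfl fun j _ => ?_
          simp only [Pi.add_apply, Pi.smul_apply, smul_eq_mul]
          ring
        rw [this]
        linear_combination hab
      rw [h1]
      exact key _ _ _ _ (hus i) (hus' i)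
    · simpa [add_dotProduct, smul_dotProduct] using key _ _ _ _ hut hut'
  have hCo : IsOpen C := by
    have : C = ⋃ u ∈ {u : Vec n | 0 ≤ u ∧ u ≤ d},
        ((⋂ i, {z : Vec m × ℝ | ∑ j, w i j * u j - 1 < z.1 i}) ∩ {z | z.2 < u ⬝ᵥ x}) := by
      ext z
      simp only [C, Set.mem_ofPred_eq, Set.mem_iUnion, Set.mem_inter_iff, Set.mem_iInter, exists_prop,
        and_assoc]
    rw [this]
    refine isOpen_biUnion fun u _ => IsOpen.inter (isOpen_iInter_of_finite fun i => ?_) ?_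
    · exact isOpen_lt continuous_const (by fun_prop)
    · exact isOpen_lt (by fun_prop) continuous_const
  have hnot : ((0 : Vec m), V) ∉ C := by
    rintro ⟨u, hu0, hud, hus, hut⟩
    refine absurd (hV u hu0 hud fun i => ?_) (not_le.2 hut)
    have := hus i
    simp only [Pi.zero_apply] at this
    linarith
  obtain ⟨f, hf⟩ := geometric_hahn_banach_open_point hC hCo hnot
  set lam : Vec m := fun i => -f (Pi.single i 1, 0) with hlam
  set mu : ℝ := f (0, 1) with hmu
  have hfe : ∀ (s : Vec m) (t : ℝ), f (s, t) = -∑ i, lam i * s i + t * mu := by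
    intro s t
    have h1 : (s, t) = ∑ i, s i • ((Pi.single i 1 : Vec m), (0 : ℝ)) + t • ((0 : Vec m), (1 : ℝ)) := by
      ext i
      · simp [Prod.fst_sum, Finset.sum_apply, Pi.single_apply]
      · simp [Prod.snd_sum]
    rw [h1, map_add, map_sum, map_smul, smul_eq_mul, ← Finset.sum_neg_distrib]
    congr 1
    refine Finset.sum_congr rfl fun i _ => ?_
    rw [map_smul, smul_eq_mul, hlam]
    ring
  have hf' : ∀ (s : Vec m) (t : ℝ), (s, t) ∈ C → -∑ i, lam i * s i + t * mu < V * mu := by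
    intro s t h
    have := hf _ h
    rw [hfe, hfe] at this
    simpa using this
  have hlam0 : ∀ i, 0 ≤ lam i := by
    intro i
    rw [← neg_nonpos]
    refine nonpos_of_forall_pos_mul_lt (c := V * mu + mu) fun t ht => ?_
    have h1 := hf' (Pi.single i t) (-1) ⟨0, le_rfl, hd, fun k => ?_, by simp⟩
    · simp only [Pi.single_apply, mul_ite, mul_zero, Finset.sum_ite_eq', Finset.mem_univ,
        if_true] at h1
      linarith
    · have : (0 : ℝ) ≤ (Pi.single i t : Vec m) k := by
        rw [Pi.single_apply]
        split_ifs <;> linarith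
      simp only [Pi.zero_apply, mul_zero, Finset.sum_const_zero]
      linarith
  have hmu0 : 0 ≤ mu := by
    rw [← neg_nonpos]
    refine nonpos_of_forall_pos_mul_lt (c := V * mu) fun t ht => ?_
    have h1 := hf' 0 (-t) ⟨0, le_rfl, hd, fun k => by simp, by simpa using ht⟩
    simp only [Pi.zero_apply, mul_zero, Finset.sum_const_zero] at h1
    linarith
  -- Slater's condition: u = 0 satisfies every row with room to spare, so the separating hyperplane
  -- cannot be vertical.
  have hmu1 : 0 < mu := by
    refine lt_of_le_of_ne hmu0 fun h0 => ?_
    have h1 := hf' (fun _ => -1 / 2) (-1) ⟨0, le_rfl, hd, fun k => by norm_num, by simp⟩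
    rw [← h0, ← Finset.sum_mul] at h1
    have := Finset.sum_nonneg fun i (_ : i ∈ Finset.univ) => hlam0 i
    linarith
  refine ⟨fun i => lam i / mu, fun i => div_nonneg (hlam0 i) hmu0, fun u hu0 hud => ?_⟩
  -- The point belonging to u lies only on the boundary of `C`; shift it inside by δ and let δ tend
  -- to 0.
  have h1 : -∑ i, lam i * (∑ j, w i j * u j - 1) + (u ⬝ᵥ x) * mu ≤ V * mu := by
    refine le_of_forall_pos_add_mul_lt (b := -∑ i, lam i - mu) fun δ hδ => ?_
    have h2 := hf' (fun i => ∑ j, w i j * u j - 1 + δ) (u ⬝ᵥ x - δ)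
      ⟨u, hu0, hud, fun i => by simpa using hδ, by simpa using hδ⟩
    simp only [mul_add (lam _), Finset.sum_add_distrib, ← Finset.sum_mul] at h2
    linarith
  have h3 : ∑ i, lam i / mu * (1 - ∑ j, w i j * u j)
      = (-∑ i, lam i * (∑ j, w i j * u j - 1)) / mu := by
    rw [neg_div, Finset.sum_div, ← Finset.sum_neg_distrib]
    refine Finset.sum_congr rfl fun i _ => ?_
    ring
  rw [h3, ← le_sub_iff_add_le', div_le_iff₀ hmu1]
  linarith

/-! ### Rounding to a geometric grid -/

/-- The number of values of a coordinate in the grid. -/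
noncomputable def gridSize (m : ℕ) (ε : ℝ) : ℕ :=
  ⌊Real.logb (1 + ε) ((1 + ε) * m / ε)⌋₊

/-- The point of the grid at level `k` with coordinate exponents `f`. -/
noncomputable def gridPoint {m : ℕ} (ε lo : ℝ) (k : ℕ) (f : Fin m → ℕ) : Vec m :=
  fun i => lo * (1 + ε) ^ k * (ε / m) * (1 + ε) ^ f i

/-- The origin together with the grid points of level at most `M`. -/
noncomputable def grid (m : ℕ) (ε lo : ℝ) (M : ℕ) : Finset (Vec m) :=
  insert 0 (((Finset.univ : Finset (Fin (M + 1) × (Fin m → Fin (gridSize m ε)))).image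
    fun z => gridPoint ε lo z.1 fun i => z.2 i))

lemma grid_nonneg {m : ℕ} {ε lo : ℝ} (hε : 0 < ε) (hlo : 0 < lo) {M : ℕ} {p : Vec m}
    (hp : p ∈ grid m ε lo M) : 0 ≤ p := by
  simp only [grid, Finset.mem_insert, Finset.mem_image] at hp
  rcases hp with rfl | ⟨z, -, rfl⟩
  · exact le_rfl
  · intro i
    simp only [gridPoint, Pi.zero_apply]
    positivity

lemma card_grid_le (m : ℕ) (ε lo : ℝ) (M : ℕ) :
    (grid m ε lo M).card ≤ (M + 1) * gridSize m ε ^ m + 1 := by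
  refine (Finset.card_insert_le _ _).trans (Nat.add_le_add_right ?_ 1)
  refine Finset.card_image_le.trans ?_
  simp

/-- The least grid value above `y` exceeds it by a factor of at most `1 + ε`, unless it is the
first one. -/
lemma exists_pow_ge {ε a y : ℝ} {N : ℕ} (hε : 0 < ε) (h : y ≤ a * (1 + ε) ^ N) :
    ∃ k ≤ N, y ≤ a * (1 + ε) ^ k ∧ (k = 0 ∨ a * (1 + ε) ^ k < (1 + ε) * y) := by
  classical
  have hex : ∃ k, y ≤ a * (1 + ε) ^ k := ⟨N, h⟩
  refine ⟨Nat.find hex, Nat.find_min' hex h, Nat.find_spec hex, ?_⟩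
  rcases Nat.eq_zero_or_pos (Nat.find hex) with h0 | h0
  · exact Or.inl h0
  · right
    obtain ⟨k, hk⟩ := Nat.exists_eq_succ_of_ne_zero h0.ne'
    have h1 := not_le.1 (Nat.find_min hex (m := k) (by omega))
    rw [hk, pow_succ]
    nlinarith

lemma one_lt_gridBase {m : ℕ} {ε : ℝ} (hm : 1 ≤ m) (hε : 0 < ε) (hε1 : ε ≤ 1) :
    1 + ε ≤ (1 + ε) * m / ε := by
  have : (1 : ℝ) ≤ m := by exact_mod_cast hm
  rw [le_div_iff₀ hε]
  nlinarith

lemma one_le_gridLog {m : ℕ} {ε : ℝ} (hm : 1 ≤ m) (hε : 0 < ε) (hε1 : ε ≤ 1) :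
    1 ≤ Real.logb (1 + ε) ((1 + ε) * m / ε) := by
  have h := one_lt_gridBase hm hε hε1
  rw [Real.le_logb_iff_rpow_le (by linarith) (by linarith), Real.rpow_one]
  exact h

lemma one_le_gridSize {m : ℕ} {ε : ℝ} (hm : 1 ≤ m) (hε : 0 < ε) (hε1 : ε ≤ 1) :
    1 ≤ gridSize m ε :=
  Nat.le_floor (by simpa using one_le_gridLog hm hε hε1)

/-- The floor loses less than one factor 1 + ε, which the factor 1 + ε inside the logarithm makes up
for. Rounding down keeps the m-th power in the call bound free of a constant to the power m. -/
lemma div_lt_pow_gridSize {m : ℕ} {ε : ℝ} (hm : 1 ≤ m) (hε : 0 < ε) (hε1 : ε ≤ 1) :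
    m / ε < (1 + ε) ^ gridSize m ε := by
  have h := one_lt_gridBase hm hε hε1
  have h1 := Nat.lt_floor_add_one (Real.logb (1 + ε) ((1 + ε) * m / ε))
  rw [Real.logb_lt_iff_lt_rpow (by linarith) (by linarith)] at h1
  have h2 : (1 + ε) * (m / ε) < (1 + ε) * (1 + ε) ^ gridSize m ε := by
    calc (1 + ε) * (m / ε) = (1 + ε) * m / ε := by ring
      _ < _ := h1
      _ = (1 + ε) * (1 + ε) ^ gridSize m ε := by
        rw [← pow_succ', ← Real.rpow_natCast, gridSize]
        push_cast
        rfl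
  exact lt_of_mul_lt_mul_left h2 (by linarith)

/-- Rounding up to the grid. -/
lemma exists_grid_ge {m : ℕ} {ε lo : ℝ} {M : ℕ} (hm : 1 ≤ m) (hε : 0 < ε) (hε1 : ε ≤ 1)
    (hlo : 0 < lo) (p : Vec m) (hp : 0 ≤ p) (hM : (1 + ε) * ∑ i, p i ≤ lo * (1 + ε) ^ M) :
    ∃ q ∈ grid m ε lo M, p ≤ q ∧ ∑ i, q i ≤ (1 + 5 * ε) * ∑ i, p i + ε * lo := by
  set s := ∑ i, p i with hs
  have hs0 : 0 ≤ s := Finset.sum_nonneg fun i _ => hp i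
  have hm0 : (0 : ℝ) < m := by exact_mod_cast hm
  -- The level is chosen for (1 + ε)s rather than s because the top coordinate value of a level is
  -- only guaranteed to reach β/(1 + ε).
  obtain ⟨k, hkM, hk, hk'⟩ := exists_pow_ge hε hM
  set β := lo * (1 + ε) ^ k with hβ
  have hβ0 : 0 < β := by positivity
  -- Above the first level β < (1 + ε)²s ≤ 4s. Lifting small coordinates to βε/m costs at most βε in
  -- total, whence 4ε + ε = 5ε and the additive ε · lo.
  have hβs : β ≤ lo + 4 * s := by
    rcases hk' with h | h
    · rw [hβ, h]
      simpa using hs0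
    · nlinarith [mul_nonneg hs0 hε.le]
  have hN := one_le_gridSize hm hε hε1
  have hpi : ∀ i, p i ≤ β * (ε / m) * (1 + ε) ^ (gridSize m ε - 1) := by
    intro i
    have h1 : p i ≤ s := Finset.single_le_sum (fun i _ => hp i) (Finset.mem_univ i)
    have h2 := div_lt_pow_gridSize hm hε hε1
    rw [← Nat.sub_add_cancel hN, pow_succ] at h2
    set y := (1 + ε) ^ (gridSize m ε - 1)
    have h3 : 1 ≤ ε / m * y * (1 + ε) := by
      have := mul_lt_mul_of_pos_left h2 (show 0 < ε / m by positivity)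
      rw [show ε / m * (m / ε) = 1 by field_simp] at this
      linarith
    have h4 : (1 + ε) * p i ≤ (1 + ε) * (β * (ε / m) * y) := by
      nlinarith [mul_le_mul_of_nonneg_left h3 hβ0.le]
    exact le_of_mul_le_mul_left h4 (by linarith)
  choose f hfN hf hf' using fun i => exists_pow_ge hε (hpi i)
  refine ⟨gridPoint ε lo k f, ?_, hf, ?_⟩
  · refine Finset.mem_insert_of_mem (Finset.mem_image.2
      ⟨(⟨k, by omega⟩, fun i => ⟨f i, ?_⟩), Finset.mem_univ _, rfl⟩)
    have := hfN i
    omega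
  · have h1 : ∀ i, gridPoint ε lo k f i ≤ β * (ε / m) + (1 + ε) * p i := by
      intro i
      have h0 : 0 ≤ (1 + ε) * p i := mul_nonneg (by linarith) (hp i)
      have hq : 0 < β * (ε / m) := by positivity
      change β * (ε / m) * (1 + ε) ^ f i ≤ _
      rcases hf' i with h | h
      · rw [h]
        linarith
      · linarith
    calc ∑ i, gridPoint ε lo k f i ≤ ∑ i, (β * (ε / m) + (1 + ε) * p i) :=
          Finset.sum_le_sum fun i _ => h1 i
      _ = β * ε + (1 + ε) * s := by
          rw [Finset.sum_add_distrib, ← Finset.mul_sum (Finset.univ) p, ← hs, Finset.sum_const, Finset.card_univ,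
            Fintype.card_fin, nsmul_eq_mul]
          field_simp
      _ ≤ _ := by nlinarith

/-! ### The dual of the adversarial problem -/

namespace PolyData

variable {n m : ℕ}

/-- The coefficients `a_ij / b_i`; those of a row with `b_i = 0` are set to `0`. -/
noncomputable def weight (I : PolyData n m) (i : Fin m) (j : Fin n) : ℝ := I.A i j / I.b i

open Classical in
/-- The upper bounds, with those of the inactive columns set to `0`. -/
noncomputable def bound (I : PolyData n m) (j : Fin n) : ℝ := if I.Active j then I.d j else 0

/-- The part of the unit budget of column `j` that is not covered by the multiplier `p`. -/
noncomputable def slack (I : PolyData n m) (p : Vec m) (j : Fin n) : ℝ :=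
  max 0 (1 - ∑ i, I.weight i j * p i)

/-- The nominal objective that belongs to the multiplier `p`. -/
noncomputable def objective (I : PolyData n m) (p : Vec m) : Vec n :=
  fun j => I.c0 j + I.bound j * I.slack p j

/-- The Lagrangian bound on the worst-case cost of `x`. -/
noncomputable def dualValue (I : PolyData n m) (p : Vec m) (x : Vec n) : ℝ :=
  ∑ i, p i + I.objective p ⬝ᵥ x

/-- The columns on which the multipliers have an effect. -/
def Relevant (I : PolyData n m) (j : Fin n) : Prop := I.Active j ∧ ∃ i, 0 < I.A i j

variable (I : PolyData n m)

lemma weight_nonneg (i : Fin m) (j : Fin n) : 0 ≤ I.weight i j :=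
  div_nonneg (I.A_nonneg i j) (I.b_nonneg i)

lemma bound_nonneg (j : Fin n) : 0 ≤ I.bound j := by
  rw [bound]
  split_ifs
  · exact I.d_nonneg j
  · exact le_rfl

lemma slack_nonneg (p : Vec m) (j : Fin n) : 0 ≤ I.slack p j := le_max_left _ _

lemma slack_zero (j : Fin n) : I.slack 0 j = 1 := by simp [slack]

lemma slack_anti {p q : Vec m} (h : p ≤ q) (j : Fin n) : I.slack q j ≤ I.slack p j := by
  refine max_le_max le_rfl (sub_le_sub_left ?_ _)
  exact Finset.sum_le_sum fun i _ => mul_le_mul_of_nonneg_left (h i) (I.weight_nonneg i j)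

lemma objective_nonneg (p : Vec m) : 0 ≤ I.objective p := fun j =>
  add_nonneg (I.c0_nonneg j) (mul_nonneg (I.bound_nonneg j) (I.slack_nonneg p j))

lemma objective_anti {p q : Vec m} (h : p ≤ q) : I.objective q ≤ I.objective p := fun j =>
  add_le_add_right (mul_le_mul_of_nonneg_left (I.slack_anti h j) (I.bound_nonneg j)) _

lemma weight_le_colMax (i : Fin m) (j : Fin n) : I.weight i j ≤ I.colMax j :=
  le_ciSup (f := fun i => I.A i j / I.b i) (Set.finite_range _).bddAbove i

lemma bound_eq_zero_or_weight_eq_zero {j : Fin n} (hj : ¬ I.Relevant j) :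
    I.bound j = 0 ∨ ∀ i, I.weight i j = 0 := by
  by_cases h : I.Active j
  · refine Or.inr fun i => ?_
    have : ¬ 0 < I.A i j := fun hi => hj ⟨h, i, hi⟩
    rw [weight, le_antisymm (not_lt.1 this) (I.A_nonneg i j), zero_div]
  · exact Or.inl (if_neg h)

lemma bound_mul_slack_of_not_relevant {j : Fin n} (hj : ¬ I.Relevant j) (p : Vec m) :
    I.bound j * I.slack p j = I.bound j := by
  rcases I.bound_eq_zero_or_weight_eq_zero hj with h | h
  · simp [h]
  · simp [slack, h]

/-- A row with b_i = 0 only forces u_j = 0 where a_ij > 0, and this is recorded in `bound`. Since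
division by 0 gives 0, its normalized form is the void constraint 0 ≤ 1. -/
lemma mem_uncertainty_iff (c : Vec n) : c ∈ I.uncertainty ↔ ∃ u : Vec n, 0 ≤ u ∧
    u ≤ I.bound ∧ (∀ i, ∑ j, I.weight i j * u j ≤ 1) ∧ c = I.c0 + u := by
  constructor
  · rintro ⟨u, h0, hd, hA, rfl⟩
    refine ⟨u, h0, fun j => ?_, fun i => ?_, rfl⟩
    · by_cases hj : I.Active j
      · rw [bound, if_pos hj]
        exact hd j
      · rw [bound, if_neg hj]
        by_contra! hu
        refine hj ⟨hu.trans_le (hd j), fun i hi => ?_⟩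
        have h1 : I.A i j * u j ≤ I.A.mulVec u i :=
          Finset.single_le_sum (f := fun j => I.A i j * u j)
            (fun j _ => mul_nonneg (I.A_nonneg i j) (h0 j)) (Finset.mem_univ j)
        have h2 := h1.trans (hA i)
        rw [hi] at h2
        nlinarith [I.A_nonneg i j]
    · have h1 : ∑ j, I.weight i j * u j = I.A.mulVec u i / I.b i := by
        rw [Matrix.mulVec, dotProduct, Finset.sum_div]
        exact Finset.sum_congr rfl fun j _ => div_mul_eq_mul_div _ _ _
      rw [h1]
      exact div_le_one_of_le₀ (hA i) (I.b_nonneg i)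
  · rintro ⟨u, h0, hd, hw, rfl⟩
    refine ⟨u, h0, fun j => (hd j).trans ?_, fun i => ?_, rfl⟩
    · rw [bound]
      split_ifs
      · exact le_rfl
      · exact I.d_nonneg j
    · rcases (show (0 : ℝ) ≤ I.b i from I.b_nonneg i).eq_or_lt' with hb | hb
      · rw [hb, Matrix.mulVec, dotProduct]
        refine (Finset.sum_eq_zero fun j _ => ?_).le
        by_cases hj : I.Active j
        · rw [hj.2 i hb, zero_mul]
        · have := hd j
          rw [bound, if_neg hj] at this
          rw [le_antisymm this (show (0 : ℝ) ≤ u j from h0 j), mul_zero]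
      · have h1 : I.A.mulVec u i = I.b i * ∑ j, I.weight i j * u j := by
          rw [Matrix.mulVec, dotProduct, Finset.mul_sum]
          refine Finset.sum_congr rfl fun j _ => ?_
          rw [weight]
          field_simp
        rw [h1]
        exact mul_le_of_le_one_right hb.le (hw i)

lemma c0_mem_uncertainty : I.c0 ∈ I.uncertainty :=
  (I.mem_uncertainty_iff _).2
    ⟨0, le_rfl, fun j => I.bound_nonneg j, fun i => by simp, (add_zero _).symm⟩

lemma dualValue_eq (p : Vec m) (x : Vec n) :
    I.dualValue p x = ∑ i, p i + (I.c0 ⬝ᵥ x + ∑ j, I.bound j * I.slack p j * x j) := by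
  rw [dualValue, dotProduct, dotProduct, ← Finset.sum_add_distrib]
  congr 1
  exact Finset.sum_congr rfl fun j _ => add_mul _ _ _

/-- Weak duality. -/
lemma dotProduct_le_dualValue {x : Vec n} (hx : IsBinary {x}) {c : Vec n}
    (hc : c ∈ I.uncertainty) {p : Vec m} (hp : 0 ≤ p) : c ⬝ᵥ x ≤ I.dualValue p x := by
  obtain ⟨u, h0, hd, hw, rfl⟩ := (I.mem_uncertainty_iff c).1 hc
  have hpw : ∑ j, u j * ∑ i, I.weight i j * p i ≤ ∑ i, p i := by
    calc ∑ j, u j * ∑ i, I.weight i j * p i = ∑ i, p i * ∑ j, I.weight i j * u j := by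
          simp_rw [Finset.mul_sum]
          rw [Finset.sum_comm]
          exact Finset.sum_congr rfl fun i _ => Finset.sum_congr rfl fun j _ => by ring
      _ ≤ _ := Finset.sum_le_sum fun i _ => mul_le_of_le_one_right (hp i) (hw i)
  have hj : ∀ j, (I.c0 + u) j * x j ≤
      u j * ∑ i, I.weight i j * p i + I.objective p j * x j := by
    intro j
    have hs : 1 - ∑ i, I.weight i j * p i ≤ I.slack p j := le_max_right _ _
    have hs0 := I.slack_nonneg p j
    have hu0 : 0 ≤ u j := h0 j
    have hu : u j * I.slack p j ≤ I.bound j * I.slack p j := mul_le_mul_of_nonneg_right (hd j) hs0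
    have hwp : 0 ≤ ∑ i, I.weight i j * p i :=
      Finset.sum_nonneg fun i _ => mul_nonneg (I.weight_nonneg i j) (hp i)
    rcases hx x rfl j with h | h
    · rw [h]
      simpa using mul_nonneg hu0 hwp
    · simp only [h, Pi.add_apply, objective, mul_one]
      nlinarith [mul_le_mul_of_nonneg_left hs hu0]
  calc (I.c0 + u) ⬝ᵥ x ≤ ∑ j, (u j * ∑ i, I.weight i j * p i + I.objective p j * x j) :=
        Finset.sum_le_sum fun j _ => hj j
    _ ≤ _ := by
        rw [Finset.sum_add_distrib]
        exact add_le_add_left hpw _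

lemma bddAbove_cost {x : Vec n} (hx : IsBinary {x}) :
    BddAbove ((fun c : Vec n => c ⬝ᵥ x) '' I.uncertainty) :=
  ⟨I.dualValue 0 x, by
    rintro _ ⟨c, hc, rfl⟩
    exact I.dotProduct_le_dualValue hx hc le_rfl⟩

lemma worstCost_le_dualValue {x : Vec n} (hx : IsBinary {x}) {p : Vec m} (hp : 0 ≤ p) :
    worstCost I.uncertainty x ≤ I.dualValue p x := by
  refine csSup_le ⟨_, Set.mem_image_of_mem _ I.c0_mem_uncertainty⟩ ?_
  rintro _ ⟨c, hc, rfl⟩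
  exact I.dotProduct_le_dualValue hx hc hp

/-- Strong duality. -/
lemma exists_dualValue_le_worstCost {x : Vec n} (hx : IsBinary {x}) :
    ∃ p : Vec m, 0 ≤ p ∧ I.dualValue p x ≤ worstCost I.uncertainty x := by
  classical
  obtain ⟨p, hp, h⟩ := exists_multiplier I.weight I.bound x (fun j => I.bound_nonneg j)
    (worstCost I.uncertainty x - I.c0 ⬝ᵥ x) (by
      intro u h0 hd hw
      rw [le_sub_iff_add_le', ← add_dotProduct]
      exact le_csSup (I.bddAbove_cost hx)
        ⟨_, (I.mem_uncertainty_iff _).2 ⟨u, h0, hd, hw, rfl⟩, rfl⟩)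
  refine ⟨p, hp, ?_⟩
  -- This u maximizes the Lagrangian at p over the box, coordinate by coordinate; the maximum is the
  -- dual value without the c⁰ term.
  let u : Vec n := fun j => if x j = 1 ∧ 0 ≤ 1 - ∑ i, I.weight i j * p i then I.bound j else 0
  have h1 := h u (fun j => by
      simp only [u, Pi.zero_apply]
      split_ifs
      exacts [I.bound_nonneg j, le_rfl]) (fun j => by
      simp only [u]
      split_ifs
      exacts [le_rfl, I.bound_nonneg j])
  have h2 : ∑ i, p i * (1 - ∑ j, I.weight i j * u j)
      = ∑ i, p i - ∑ j, u j * ∑ i, I.weight i j * p i := by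
    simp_rw [mul_sub, Finset.sum_sub_distrib, mul_one, Finset.mul_sum]
    rw [Finset.sum_comm]
    congr 1
    exact Finset.sum_congr rfl fun j _ => Finset.sum_congr rfl fun i _ => by ring
  have h3 : u ⬝ᵥ x - ∑ j, u j * ∑ i, I.weight i j * p i
      = ∑ j, I.bound j * I.slack p j * x j := by
    rw [dotProduct, ← Finset.sum_sub_distrib]
    refine Finset.sum_congr rfl fun j _ => ?_
    rcases hx x rfl j with h | h
    · simp [u, h]
    · by_cases hs : 0 ≤ 1 - ∑ i, I.weight i j * p i
      · simp only [u, h, hs, slack, max_eq_right, and_self, if_true]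
        ring
      · simp only [u, h, hs, slack, max_eq_left (not_le.1 hs).le, and_false, if_false]
        ring
  rw [dualValue_eq]
  linarith

end PolyData

/-! ### The grid of multipliers -/

namespace PolyData

variable {n m : ℕ} (I : PolyData n m)

/-- Irrelevant columns contribute equally at every multiplier. Hence passing from 0 to p saves at
most D in each relevant column, and ∑ p_i cannot exceed the total saving. -/
lemma sum_le_mul_of_bound_le {x : Vec n} (hx : IsBinary {x}) {p : Vec m} {D : ℝ} (hD0 : 0 ≤ D)
    (hD : ∀ j, I.Relevant j → I.d j ≤ D) (h : I.dualValue p x ≤ I.dualValue 0 x) :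
    ∑ i, p i ≤ n * D := by
  have h1 : ∑ j, I.bound j * I.slack 0 j * x j
      ≤ ∑ j, (D + I.bound j * I.slack p j * x j) := by
    refine Finset.sum_le_sum fun j _ => ?_
    rcases hx x rfl j with hj | hj
    · simpa [hj] using hD0
    · rw [hj, mul_one, mul_one]
      by_cases hr : I.Relevant j
      · have h2 : I.bound j ≤ D := by
          rw [bound, if_pos hr.1]
          exact hD j hr
        rw [slack_zero, mul_one]
        linarith [mul_nonneg (I.bound_nonneg j) (I.slack_nonneg p j)]
      · rw [I.bound_mul_slack_of_not_relevant hr, I.bound_mul_slack_of_not_relevant hr]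
        linarith
  rw [Finset.sum_add_distrib, Finset.sum_const, Finset.card_univ, Fintype.card_fin,
    nsmul_eq_mul] at h1
  rw [dualValue_eq, dualValue_eq] at h
  simp only [Pi.zero_apply, Finset.sum_const_zero] at h
  linarith

lemma colMax_le_sum_weight (j : Fin n) : I.colMax j ≤ ∑ i, I.weight i j := by
  refine Real.iSup_le (fun i => ?_) (Finset.sum_nonneg fun i _ => I.weight_nonneg i j)
  exact Finset.single_le_sum (f := fun i => I.weight i j) (fun i _ => I.weight_nonneg i j)
    (Finset.mem_univ i)

/-- The constant multiplier 1/W already wipes out the slack of every relevant column at the price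
m/W, so a p that is no worse cannot cost more. -/
lemma sum_le_div_of_le_colMax {x : Vec n} (hx : IsBinary {x}) {p : Vec m} {W : ℝ} (hW0 : 0 < W)
    (hW : ∀ j, I.Relevant j → W ≤ I.colMax j)
    (h : I.dualValue p x ≤ I.dualValue (fun _ => 1 / W) x) : ∑ i, p i ≤ m / W := by
  have h1 : ∑ j, I.bound j * I.slack (fun _ => 1 / W) j * x j
      ≤ ∑ j, I.bound j * I.slack p j * x j := by
    refine Finset.sum_le_sum fun j _ => ?_
    have hxj : 0 ≤ x j := by rcases hx x rfl j with hj | hj <;> simp [hj]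
    refine mul_le_mul_of_nonneg_right ?_ hxj
    by_cases hr : I.Relevant j
    · have h2 : I.slack (fun _ => 1 / W) j = 0 := by
        refine max_eq_left ?_
        rw [← Finset.sum_mul, mul_one_div, sub_nonpos, le_div_iff₀ hW0, one_mul]
        exact (hW j hr).trans (I.colMax_le_sum_weight j)
      rw [h2, mul_zero]
      exact mul_nonneg (I.bound_nonneg j) (I.slack_nonneg p j)
    · rw [I.bound_mul_slack_of_not_relevant hr, I.bound_mul_slack_of_not_relevant hr]
  rw [dualValue_eq, dualValue_eq] at h
  rw [Finset.sum_const, Finset.card_univ, Fintype.card_fin, nsmul_eq_mul, mul_one_div] at h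
  linarith

lemma dualValue_zero_le {x : Vec n} (hx : ∀ j, I.Relevant j → x j = 0) {p : Vec m} (hp : 0 ≤ p) :
    I.dualValue 0 x ≤ I.dualValue p x := by
  have h1 : ∑ j, I.bound j * I.slack 0 j * x j = ∑ j, I.bound j * I.slack p j * x j := by
    refine Finset.sum_congr rfl fun j _ => ?_
    by_cases hr : I.Relevant j
    · rw [hx j hr, mul_zero, mul_zero]
    · rw [I.bound_mul_slack_of_not_relevant hr, I.bound_mul_slack_of_not_relevant hr]
  rw [dualValue_eq, dualValue_eq, h1]
  have := Finset.sum_nonneg fun i (_ : i ∈ Finset.univ) => hp i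
  simp only [Pi.zero_apply, Finset.sum_const_zero] at this ⊢
  linarith

/-- One relevant column in x suffices: with P = ∑ p_i, its term is at least lo(1 − P · `colMax`) ≥
lo − P, and P itself is paid. -/
lemma le_dualValue {x : Vec n} (hx : IsBinary {x}) {p : Vec m} (hp : 0 ≤ p) {lo : ℝ}
    (hlo : 0 < lo) {j : Fin n} (hr : I.Relevant j) (hxj : x j ≠ 0) (hd : lo ≤ I.d j)
    (hw : lo * I.colMax j ≤ 1) : lo ≤ I.dualValue p x := by
  have hx0 : 0 ≤ x := fun k => by rcases hx x rfl k with hk | hk <;> simp [hk]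
  have hs0 : 0 ≤ ∑ i, p i := Finset.sum_nonneg fun i _ => hp i
  have h1 : I.bound j * I.slack p j ≤ ∑ j, I.bound j * I.slack p j * x j := by
    have := Finset.single_le_sum (f := fun j => I.bound j * I.slack p j * x j)
      (fun k _ => mul_nonneg (mul_nonneg (I.bound_nonneg k) (I.slack_nonneg p k)) (hx0 k))
      (Finset.mem_univ j)
    simpa only [(hx x rfl j).resolve_left hxj, mul_one] using this
  have h2 : 0 ≤ I.c0 ⬝ᵥ x := Finset.sum_nonneg fun k _ => mul_nonneg (I.c0_nonneg k) (hx0 k)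
  rw [dualValue_eq]
  rw [bound, if_pos hr.1] at h1
  have h3 : lo * (1 - I.colMax j * ∑ i, p i) ≤ I.d j * I.slack p j := by
    have h4 : 1 - I.colMax j * ∑ i, p i ≤ I.slack p j := by
      refine le_trans (sub_le_sub_left ?_ _) (le_max_right _ _)
      rw [Finset.mul_sum]
      exact Finset.sum_le_sum fun i _ => mul_le_mul_of_nonneg_right (I.weight_le_colMax i j) (hp i)
    calc lo * (1 - I.colMax j * ∑ i, p i) ≤ lo * I.slack p j :=
          mul_le_mul_of_nonneg_left h4 hlo.le
      _ ≤ _ := mul_le_mul_of_nonneg_right hd (I.slack_nonneg p j)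
  nlinarith [mul_le_mul_of_nonneg_right hw hs0]

lemma worstCost_nonneg {x : Vec n} (hx : IsBinary {x}) : 0 ≤ worstCost I.uncertainty x := by
  have h2 : 0 ≤ I.c0 ⬝ᵥ x := Finset.sum_nonneg fun k _ => mul_nonneg (I.c0_nonneg k) (by
    rcases hx x rfl k with hk | hk <;> simp [hk])
  exact h2.trans (le_csSup (I.bddAbove_cost hx) ⟨_, I.c0_mem_uncertainty, rfl⟩)

/-- `lo` and `r` give the scale of the data of the relevant columns. -/
structure Scale (lo r : ℝ) : Prop where
  lo_pos : 0 < lo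
  one_le : 1 ≤ r
  le_d : ∀ j, I.Relevant j → lo ≤ I.d j
  colMax_le : ∀ j, I.Relevant j → lo * I.colMax j ≤ 1
  d_le_or_le_colMax : (∀ j, I.Relevant j → I.d j ≤ r * lo) ∨
    ∀ j, I.Relevant j → 1 ≤ r * lo * I.colMax j

lemma exists_mem_grid_dualValue_le {ε lo r : ℝ} {M : ℕ} (hm : 1 ≤ m) (hε : 0 < ε) (hε1 : ε ≤ 1)
    (hs : I.Scale lo r) (hM : (1 + ε) * ((m + n) * r) ≤ (1 + ε) ^ M) {x : Vec n}
    (hx : IsBinary {x}) :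
    ∃ q ∈ grid m ε lo M, I.dualValue q x ≤ (1 + 6 * ε) * worstCost I.uncertainty x := by
  have hlo := hs.lo_pos
  have hr := hs.one_le
  have hV := I.worstCost_nonneg hx
  obtain ⟨p, hp, hpV⟩ := I.exists_dualValue_le_worstCost hx
  have hopt : ∀ q : Vec m, 0 ≤ q → I.dualValue p x ≤ I.dualValue q x := fun q hq =>
    hpV.trans (I.worstCost_le_dualValue hx hq)
  by_cases hj : ∀ j, I.Relevant j → x j = 0
  · refine ⟨0, Finset.mem_insert_self _ _, ((I.dualValue_zero_le hj hp).trans hpV).trans ?_⟩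
    nlinarith [mul_nonneg hε.le hV]
  push Not at hj
  obtain ⟨j, hjr, hxj⟩ := hj
  have hloV := I.le_dualValue hx hp hlo hjr hxj (hs.le_d j hjr) (hs.colMax_le j hjr)
  have hrl : 0 < r * lo := by positivity
  -- The comparison multiplier is 0 if the bounds d_j are at most r · lo, and constantly r · lo if
  -- the column maxima are at least 1/(r · lo).
  have hsum : ∑ i, p i ≤ (m + n) * (r * lo) := by
    rcases hs.d_le_or_le_colMax with h | h
    · have := I.sum_le_mul_of_bound_le hx hrl.le h (hopt 0 le_rfl)
      nlinarith [mul_nonneg (Nat.cast_nonneg (α := ℝ) m) hrl.le]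
    · have h1 := I.sum_le_div_of_le_colMax hx (p := p) (W := 1 / (r * lo)) (by positivity)
        (fun j hj => by
          rw [div_le_iff₀ hrl]
          linarith [h j hj]) (hopt _ fun i => by simp only [Pi.zero_apply]; positivity)
      rw [div_div_eq_mul_div, div_one] at h1
      nlinarith [mul_nonneg (Nat.cast_nonneg (α := ℝ) n) hrl.le]
  obtain ⟨q, hq, hpq, hqs⟩ := exists_grid_ge hm hε hε1 hlo p hp (M := M) (by
    nlinarith [mul_le_mul_of_nonneg_left hsum (by linarith : 0 ≤ 1 + ε)])
  refine ⟨q, hq, ?_⟩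
  have hx0 : 0 ≤ x := fun k => by rcases hx x rfl k with hk | hk <;> simp [hk]
  have h1 : I.objective q ⬝ᵥ x ≤ I.objective p ⬝ᵥ x :=
    Finset.sum_le_sum fun k _ => mul_le_mul_of_nonneg_right (I.objective_anti hpq k) (hx0 k)
  have h2 : ∑ i, p i ≤ I.dualValue p x := le_add_of_nonneg_right
    (Finset.sum_nonneg fun k _ => mul_nonneg (I.objective_nonneg p k) (hx0 k))
  calc I.dualValue q x ≤ (1 + 5 * ε) * ∑ i, p i + ε * lo + I.objective p ⬝ᵥ x :=
        add_le_add hqs h1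
    _ = I.dualValue p x + 5 * (ε * ∑ i, p i) + ε * lo := by
        rw [dualValue]
        ring
    -- Both ∑ p_i and lo are at most the dual value: 5ε from rounding, one more ε from the additive
    -- term.
    _ ≤ (1 + 6 * ε) * I.dualValue p x := by
        nlinarith [mul_le_mul_of_nonneg_left h2 hε.le, mul_le_mul_of_nonneg_left hloV hε.le]
    _ ≤ _ := mul_le_mul_of_nonneg_left hpV (by linarith)

/-- Whichever of Dmin and 1/Wmax is the smaller decides which bound on ∑ p_i applies. Thus only
ratios among the d_j or among the column maxima enter, never a ratio between the two kinds. -/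
lemma scale_of_bounds {Dmin Dmax Wmin Wmax : ℝ} (hDmin : 0 < Dmin) (hWmin : 0 < Wmin)
    (hWW : Wmin ≤ Wmax)
    (hD : ∀ j, I.Relevant j → Dmin ≤ I.d j ∧ I.d j ≤ Dmax)
    (hW : ∀ j, I.Relevant j → Wmin ≤ I.colMax j ∧ I.colMax j ≤ Wmax) :
    I.Scale (min Dmin (1 / Wmax)) (max (Wmax / Wmin) (Dmax / Dmin)) := by
  have hWmax : 0 < Wmax := hWmin.trans_le hWW
  refine ⟨by positivity, le_max_of_le_left ((one_le_div hWmin).2 hWW),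
    fun j hj => (min_le_left _ _).trans (hD j hj).1, fun j hj => ?_, ?_⟩
  · have h0 : 0 ≤ I.colMax j := hWmin.le.trans (hW j hj).1
    calc min Dmin (1 / Wmax) * I.colMax j ≤ 1 / Wmax * I.colMax j :=
          mul_le_mul_of_nonneg_right (min_le_right _ _) h0
      _ ≤ 1 := by
          rw [one_div_mul_eq_div, div_le_one hWmax]
          exact (hW j hj).2
  · rcases min_choice Dmin (1 / Wmax) with h | h
    · left
      intro j hj
      rw [h]
      calc I.d j ≤ Dmax / Dmin * Dmin := by
            rw [div_mul_cancel₀ _ hDmin.ne']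
            exact (hD j hj).2
        _ ≤ _ := mul_le_mul_of_nonneg_right (le_max_right _ _) hDmin.le
    · right
      intro j hj
      rw [h]
      calc 1 = Wmax / Wmin * (1 / Wmax) * Wmin := by field_simp
        _ ≤ max (Wmax / Wmin) (Dmax / Dmin) * (1 / Wmax) * I.colMax j := by
          gcongr
          · exact le_max_left _ _
          · exact (hW j hj).1

/-! ### Scales extracted from the data -/

lemma colMax_pos {j : Fin n} (hj : I.Relevant j) : 0 < I.colMax j := by
  obtain ⟨ha, i, hi⟩ := hj
  have hb : 0 < I.b i := lt_of_le_of_ne (I.b_nonneg i) fun h => hi.ne' (ha.2 i h.symm)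
  exact (div_pos hi hb).trans_le (I.weight_le_colMax i j)

lemma exists_pos_bounds {ι : Type*} [Finite ι] (f : ι → ℝ) :
    ∃ lo hi : ℝ, 0 < lo ∧ lo ≤ hi ∧ ∀ i, 0 < f i → lo ≤ f i ∧ f i ≤ hi := by
  obtain ⟨a, ha⟩ := (Set.finite_range f).bddAbove
  obtain ⟨b, hb⟩ := (Set.finite_range fun i => (f i)⁻¹).bddAbove
  have hb1 : 0 < max b 1 := lt_max_of_lt_right one_pos
  refine ⟨(max b 1)⁻¹, max a 1, by positivity,
    (inv_le_one_of_one_le₀ (le_max_right _ _)).trans (le_max_right _ _), fun i hi => ⟨?_, ?_⟩⟩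
  · exact inv_le_of_inv_le₀ hi ((hb ⟨i, rfl⟩).trans (le_max_left _ _))
  · exact (ha ⟨i, rfl⟩).trans (le_max_left _ _)

/-- Robustness is claimed even when L is not well defined, so a scale is needed with no control on
r. -/
lemma exists_scale : ∃ lo r, I.Scale lo r := by
  obtain ⟨a, b, ha, -, h⟩ := exists_pos_bounds I.d
  obtain ⟨a', b', ha', hab', h'⟩ := exists_pos_bounds I.colMax
  exact ⟨_, _, I.scale_of_bounds ha ha' hab' (fun j hj => h j hj.1.1)
    fun j hj => h' j (I.colMax_pos hj)⟩

lemma iInf_pos_of_finite {ι : Type*} [Finite ι] [Nonempty ι] {f : ι → ℝ} (h : ∀ i, 0 < f i) :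
    0 < ⨅ i, f i := by
  obtain ⟨i, hi⟩ := exists_eq_ciInf_of_finite (f := f)
  exact hi ▸ h i

/-- If `L` is well defined, the scale of the data is controlled by `L`. -/
lemma exists_scale_le_L (hn : 1 ≤ n) {ε : ℝ} (hε : 0 < ε) (hε1 : ε ≤ 1) (hL : I.LDefined) :
    ∃ lo r, I.Scale lo r ∧ (m + n) * r ≤ I.L ε := by
  obtain ⟨-, ⟨j₀, hj₀⟩, hcol⟩ := hL
  have : Nonempty {j // I.Active j} := ⟨⟨j₀, hj₀⟩⟩
  -- When L is well defined, active and relevant columns coincide, so the extrema in L are usable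
  -- bounds.
  have hrel : ∀ j : {j // I.Active j}, I.Relevant j := fun j => ⟨j.2, hcol j j.2⟩
  have hDmin := iInf_pos_of_finite (f := fun j : {j // I.Active j} => I.d j) fun j => j.2.1
  have hWmin := iInf_pos_of_finite (f := fun j : {j // I.Active j} => I.colMax j)
    fun j => I.colMax_pos (hrel j)
  have hb : ∀ (f : Fin n → ℝ) (j : {j // I.Active j}),
      ⨅ j : {j // I.Active j}, f j ≤ f j ∧ f j ≤ ⨆ j : {j // I.Active j}, f j := fun f j =>
    ⟨ciInf_le (f := fun j : {j // I.Active j} => f j) (Set.finite_range _).bddBelow j,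
      le_ciSup (f := fun j : {j // I.Active j} => f j) (Set.finite_range _).bddAbove j⟩
  refine ⟨_, _, I.scale_of_bounds hDmin hWmin
    ((hb I.colMax ⟨j₀, hj₀⟩).1.trans (hb I.colMax ⟨j₀, hj₀⟩).2)
    (fun j hj => hb I.d ⟨j, hj.1⟩) (fun j hj => hb I.colMax ⟨j, hj.1⟩), ?_⟩
  rw [L]
  set r := max ((⨆ j : {j // I.Active j}, I.colMax j) / (⨅ j : {j // I.Active j}, I.colMax j))
        ((⨆ j : {j // I.Active j}, I.d j) / (⨅ j : {j // I.Active j}, I.d j)) with hr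
  have hr0 : 0 ≤ r := le_max_of_le_left (div_nonneg
    (hWmin.le.trans ((hb I.colMax ⟨j₀, hj₀⟩).1.trans (hb I.colMax ⟨j₀, hj₀⟩).2)) hWmin.le)
  have hn' : (1 : ℝ) ≤ n := by exact_mod_cast hn
  have h1 : (m + n) * r ≤ ((m + n : ℕ) : ℝ) / ε * r := by
    refine mul_le_mul_of_nonneg_right ?_ hr0
    rw [le_div_iff₀ hε]
    push_cast
    exact mul_le_of_le_one_right (by positivity) hε1
  refine h1.trans ((le_max_right _ _).trans (le_mul_of_one_le_left ?_ hn'))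
  exact le_max_of_le_right (by positivity)

end PolyData

/-! ### Counting -/

lemma half_le_log_one_add {ε : ℝ} (hε : 0 < ε) (hε1 : ε ≤ 1) : ε / 2 ≤ Real.log (1 + ε) := by
  have h := Real.one_sub_inv_le_log_of_pos (show 0 < 1 + ε by linarith)
  refine le_trans ?_ h
  rw [show 1 - (1 + ε)⁻¹ = ε / (1 + ε) by field_simp; ring]
  exact div_le_div_of_nonneg_left hε.le (by linarith) (by linarith)

lemma logb_one_add_mul_le {ε y : ℝ} (hε : 0 < ε) (hε1 : ε ≤ 1) (hy : 1 ≤ y) :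
    Real.logb (1 + ε) ((1 + ε) * y) ≤ 1 + 2 * (Real.log y / ε) := by
  have h1 := half_le_log_one_add hε hε1
  have h0 : 0 < Real.log (1 + ε) := by linarith
  have hy0 : 0 ≤ Real.log y := Real.log_nonneg hy
  rw [Real.logb, Real.log_mul (by linarith) (by linarith), add_div, div_self h0.ne']
  refine add_le_add_right ?_ _
  calc Real.log y / Real.log (1 + ε) ≤ Real.log y / (ε / 2) :=
        div_le_div_of_nonneg_left hy0 (by linarith) h1
    _ = _ := by field_simp

/-- The highest level needed in a grid that spans a factor of `y`. -/
noncomputable def gridHeight (ε y : ℝ) : ℕ := ⌈Real.logb (1 + ε) ((1 + ε) * y)⌉₊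

lemma le_pow_gridHeight {ε y : ℝ} (hε : 0 < ε) (hy : 0 < y) :
    (1 + ε) * y ≤ (1 + ε) ^ gridHeight ε y := by
  have h := Nat.le_ceil (Real.logb (1 + ε) ((1 + ε) * y))
  rw [Real.logb_le_iff_le_rpow (by linarith) (by positivity), Real.rpow_natCast] at h
  exact h

lemma gridHeight_le {ε y : ℝ} (hε : 0 < ε) (hε1 : ε ≤ 1) (hy : 1 ≤ y) :
    (gridHeight ε y : ℝ) ≤ 2 + 2 * (Real.log y / ε) := by
  have h1 := logb_one_add_mul_le hε hε1 hy
  have h0 : 0 ≤ Real.logb (1 + ε) ((1 + ε) * y) :=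
    Real.logb_nonneg (by linarith) (by nlinarith)
  have h2 := Nat.ceil_lt_add_one h0
  rw [gridHeight]
  linarith

lemma half_le_log_div {ε y : ℝ} (hε : 0 < ε) (hε1 : ε ≤ 1) (hy : 2 ≤ y) :
    1 / 2 ≤ Real.log y / ε := by
  have h1 : Real.log 2 ≤ Real.log y := Real.log_le_log two_pos hy
  rw [le_div_iff₀ hε]
  linarith [Real.log_two_gt_d9]

/-- Since y ≥ 2 gives log L / ε ≥ 1/2, additive constants are absorbed: the height plus 2 is at most
4 + 2 log L / ε ≤ 10 log L / ε. -/
lemma card_grid_le_callBound {n m : ℕ} (I : PolyData n m) {ε lo y : ℝ} (hm : 1 ≤ m) (hε : 0 < ε)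
    (hε1 : ε ≤ 1) (hy : 2 ≤ y) (hyL : y ≤ I.L ε) :
    ((grid m ε lo (gridHeight ε y)).card : ℝ) ≤ 10 * callBound I ε := by
  have h1 : ((grid m ε lo (gridHeight ε y)).card : ℝ)
      ≤ (gridHeight ε y + 1) * (gridSize m ε : ℝ) ^ m + 1 := by
    exact_mod_cast card_grid_le m ε lo (gridHeight ε y)
  set Λ := Real.logb (1 + ε) ((1 + ε) * m / ε) with hΛ
  have hΛ1 : 1 ≤ Λ := one_le_gridLog hm hε hε1
  have h2 : (gridSize m ε : ℝ) ^ m ≤ Λ ^ m :=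
    pow_le_pow_left₀ (Nat.cast_nonneg _) (Nat.floor_le (by linarith)) m
  have h3 : 1 ≤ Λ ^ m := one_le_pow₀ hΛ1
  have h4 := gridHeight_le hε hε1 (by linarith : 1 ≤ y)
  have h5 : Real.log y / ε ≤ Real.log (I.L ε) / ε :=
    div_le_div_of_nonneg_right (Real.log_le_log (by linarith) hyL) hε.le
  have h6 := half_le_log_div hε hε1 hy
  have h7 : (gridHeight ε y : ℝ) + 2 ≤ 10 * (Real.log (I.L ε) / ε) := by linarith
  calc ((grid m ε lo (gridHeight ε y)).card : ℝ)
      ≤ (gridHeight ε y + 1) * (gridSize m ε : ℝ) ^ m + 1 := h1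
    _ ≤ (gridHeight ε y + 1) * Λ ^ m + Λ ^ m :=
        add_le_add (mul_le_mul_of_nonneg_left h2 (by positivity)) h3
    _ = (gridHeight ε y + 2) * Λ ^ m := by ring
    _ ≤ 10 * (Real.log (I.L ε) / ε) * Λ ^ m := mul_le_mul_of_nonneg_right h7 (by positivity)
    _ = 10 * callBound I ε := by
        rw [callBound]
        ring

lemma callBound_le {n m : ℕ} (I : PolyData n m) {ε : ℝ} (hm : 1 ≤ m) (hε : 0 < ε)
    (hε1 : ε ≤ 1) (hL : 1 ≤ I.L ε) :
    callBound I ε ≤ (1 + 2 * m : ℝ) ^ m * (Real.log (I.L ε) + 1 / ε) ^ (2 + 2 * m) := by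
  set X := Real.log (I.L ε) + 1 / ε with hX
  have hl : 0 ≤ Real.log (I.L ε) := Real.log_nonneg hL
  have hε' : 1 ≤ 1 / ε := (one_le_div hε).2 hε1
  have hX1 : 1 ≤ X := by linarith
  have hm' : (1 : ℝ) ≤ m := by exact_mod_cast hm
  have hme : 1 ≤ m / ε := by
    rw [le_div_iff₀ hε]
    linarith
  have h1 : Real.logb (1 + ε) ((1 + ε) * m / ε) ≤ (1 + 2 * m) * X ^ 2 := by
    have h2 := logb_one_add_mul_le hε hε1 hme
    rw [← mul_div_assoc] at h2
    -- The crude estimate log t ≤ t is enough here: each of the m logarithmic factors then costs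
    -- degree 2.
    have h3 : Real.log (m / ε) / ε ≤ m * (1 / ε) ^ 2 := by
      calc Real.log (m / ε) / ε ≤ m / ε / ε :=
            div_le_div_of_nonneg_right (Real.log_le_self (by linarith)) hε.le
        _ = _ := by field_simp
    have h4 : (1 / ε) ^ 2 ≤ X ^ 2 := pow_le_pow_left₀ (by linarith) (by linarith) 2
    have h5 : 1 ≤ X ^ 2 := one_le_pow₀ hX1
    nlinarith [mul_le_mul_of_nonneg_left h4 (by linarith : (0 : ℝ) ≤ m)]
  have h0 := one_le_gridLog hm hε hε1
  have h6 : Real.log (I.L ε) / ε ≤ X ^ 2 := by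
    rw [div_eq_mul_one_div, sq]
    exact mul_le_mul (by linarith) (by linarith) (by linarith) (by linarith)
  calc callBound I ε ≤ X ^ 2 * ((1 + 2 * m) * X ^ 2) ^ m :=
        mul_le_mul h6 (pow_le_pow_left₀ (by linarith) h1 m) (by positivity) (by positivity)
    _ = _ := by
        rw [mul_pow, ← pow_mul]
        ring

/-! ### The algorithm -/

namespace OracleAlg

variable {Query Answer Output : Type}

/-- Ask all queries of a list, and compute the output from the answers. -/
def askAll : List Query → (List Answer → Output) → OracleAlg Query Answer Output
  | [], k => output (k [])
  | q :: l, k => ask q fun a => askAll l fun as => k (a :: as)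

lemma run_askAll (O : Query → Answer) (l : List Query) (k : List Answer → Output) :
    run O (askAll l k) = k (l.map O) := by
  induction l generalizing k with
  | nil => rfl
  | cons q l ih => exact ih _

lemma queries_askAll (O : Query → Answer) (l : List Query) (k : List Answer → Output) :
    queries O (askAll l k) = l := by
  induction l generalizing k with
  | nil => rfl
  | cons q l ih => exact congrArg (q :: ·) (ih _)

end OracleAlg

/-- Run an algorithm that is based on an approximation algorithm for the nominal problem, by
rounding a solution of the LP relaxation whenever the approximation algorithm is called. -/
def ApxAlg.toGapAlg {n : ℕ} : ApxAlg n → GapAlg n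
  | .output o => .output o
  | .ask c next => .ask (.solveLP c) fun x => .ask (.verify c x) fun y => toGapAlg (next y)

lemma ApxAlg.result_toGapAlg {n : ℕ} (P : ApxAlg n) (lp : Vec n → Vec n)
    (ver : Vec n → Vec n → Vec n) :
    P.toGapAlg.result lp ver = P.result fun c => ver c (lp c) := by
  induction P with
  | output o => rfl
  | ask c next ih => exact ih _

lemma ApxAlg.verifierCalls_toGapAlg {n : ℕ} (P : ApxAlg n) (lp : Vec n → Vec n)
    (ver : Vec n → Vec n → Vec n) :
    P.toGapAlg.verifierCalls lp ver = P.calls fun c => ver c (lp c) := by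
  induction P with
  | output o => rfl
  | ask c next ih =>
    have := ih (ver c (lp c))
    simp only [GapAlg.verifierCalls, ApxAlg.calls] at this
    simp only [GapAlg.verifierCalls, ApxAlg.calls, ApxAlg.toGapAlg, OracleAlg.queries, GapQuery.answer,
      List.countP_cons, List.length_cons, this]
    rfl

lemma ApxAlg.lpCalls_toGapAlg {n : ℕ} (P : ApxAlg n) (lp : Vec n → Vec n)
    (ver : Vec n → Vec n → Vec n) :
    P.toGapAlg.lpCalls lp ver = P.calls fun c => ver c (lp c) := by
  induction P with
  | output o => rfl
  | ask c next ih =>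
    have := ih (ver c (lp c))
    simp only [GapAlg.lpCalls, ApxAlg.calls] at this
    simp only [GapAlg.lpCalls, ApxAlg.calls, ApxAlg.toGapAlg, OracleAlg.queries, GapQuery.answer,
      List.countP_cons, List.length_cons, this]
    rfl

/-- The LP optimum over Q ⊇ S is a lower bound for the nominal optimum. -/
lemma IsGapVerifier.isApproxAlgorithm {n : ℕ} {α : ℝ} (hα : 1 ≤ α) {S Q : Set (Vec n)}
    (hSQ : S ⊆ Q) {lp : Vec n → Vec n} {ver : Vec n → Vec n → Vec n}
    (hver : IsGapVerifier α S Q ver) (hlp : IsLPSolver Q lp) :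
    IsApproxAlgorithm α S fun c => ver c (lp c) := by
  intro c hc
  obtain ⟨h1, h2⟩ := hlp c hc
  obtain ⟨h3, h4⟩ := hver c (lp c) hc h1
  exact ⟨h3, fun y hy => h4.trans (mul_le_mul_of_nonneg_left (h2 y (hSQ hy)) (by linarith))⟩

/-! ### Search over a finite set of multipliers -/

namespace PolyData

variable {n m : ℕ} (I : PolyData n m)

/-- Call the approximation algorithm for all multipliers of a list, and return the solution with
the least Lagrangian bound. -/
noncomputable def search (l : List (Vec m)) : ApxAlg n :=
  OracleAlg.askAll (l.map I.objective) fun as =>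
    -- The default 0 matters only for an empty list of multipliers.
    (((l.zip as).argmin fun z => I.dualValue z.1 z.2).map Prod.snd).getD 0

lemma calls_search (l : List (Vec m)) (apx : Vec n → Vec n) :
    (I.search l).calls apx = l.length := by
  rw [ApxAlg.calls, search, OracleAlg.queries_askAll, List.length_map]

lemma exists_result_search {l : List (Vec m)} (hl : l ≠ []) (apx : Vec n → Vec n) :
    ∃ p ∈ l, (I.search l).result apx = apx (I.objective p) ∧
      ∀ q ∈ l, I.dualValue p (apx (I.objective p)) ≤ I.dualValue q (apx (I.objective q)) := by
  set l' := l.map fun p => (p, apx (I.objective p)) with hl'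
  have hzip : l.zip ((l.map I.objective).map apx) = l' := by
    rw [List.map_map, List.zip_map_right, hl']
    simp [List.zip_eq_zipWith, List.zipWith_self]
  set f : Vec m × Vec n → ℝ := fun z => I.dualValue z.1 z.2 with hf
  obtain ⟨z, hz⟩ : ∃ z, l'.argmin f = some z := by
    rw [← Option.ne_none_iff_exists', ne_eq, List.argmin_eq_none]
    simpa [hl'] using hl
  obtain ⟨p, hp, rfl⟩ := List.mem_map.1 (List.argmin_mem hz)
  refine ⟨p, hp, ?_, fun q hq => ?_⟩
  · rw [ApxAlg.result, search, OracleAlg.run_askAll, hzip, hz]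
    rfl
  · exact List.le_of_mem_argmin (f := f) (List.mem_map.2 ⟨q, hq, rfl⟩) hz

/-- The returned solution is certified by its own multiplier through weak duality. Optimality of
that bound allows comparison with the multiplier q that is good for a robust optimum x; the oracle
loses α on the linear part only, and α ≥ 1 covers ∑ q_i. -/
lemma isDeterministicallyRobust_search {G : Finset (Vec m)} {β : ℝ}
    (hG0 : ∀ p ∈ G, 0 ≤ p)
    (hG : ∀ x : Vec n, IsBinary {x} →
      ∃ q ∈ G, I.dualValue q x ≤ β * worstCost I.uncertainty x)
    {α : ℝ} (hα : 1 ≤ α) {S : Set (Vec n)} (hS : S.Nonempty) (hSb : IsBinary S)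
    {apx : Vec n → Vec n} (hapx : IsApproxAlgorithm α S apx) :
    IsDeterministicallyRobust (α * β) S I.uncertainty ((I.search G.toList).result apx) := by
  have hSb' : ∀ x ∈ S, IsBinary {x} := by
    rintro x hx _ rfl
    exact hSb _ hx
  obtain ⟨x₀, hx₀⟩ := hS
  obtain ⟨q₀, hq₀, -⟩ := hG x₀ (hSb' x₀ hx₀)
  have hl : G.toList ≠ [] := List.ne_nil_of_mem (Finset.mem_toList.2 hq₀)
  obtain ⟨p, hp, hres, hmin⟩ := I.exists_result_search hl apx
  have hp0 := hG0 p (Finset.mem_toList.1 hp)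
  have hpS := (hapx _ (I.objective_nonneg p)).1
  rw [hres]
  refine ⟨hpS, fun c hc => (I.dotProduct_le_dualValue (hSb' _ hpS) hc hp0).trans ?_⟩
  -- Finiteness of S makes the infimum defining OPT_R attained.
  have hfin : S.Finite := by
    refine (Set.Finite.pi' (t := fun _ : Fin n => ({0, 1} : Set ℝ))
      fun _ => Set.toFinite _).subset fun x hx j => ?_
    simpa using hSb x hx j
  obtain ⟨x, hx, hxopt⟩ : robustOpt S I.uncertainty ∈ worstCost I.uncertainty '' S :=
    Set.Nonempty.csInf_mem ⟨_, x₀, hx₀, rfl⟩ (hfin.image _)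
  obtain ⟨q, hq, hqx⟩ := hG x (hSb' x hx)
  have hs : 0 ≤ ∑ i, q i := Finset.sum_nonneg fun i _ => hG0 q hq i
  calc I.dualValue p (apx (I.objective p)) ≤ I.dualValue q (apx (I.objective q)) :=
        hmin q (Finset.mem_toList.2 hq)
    _ ≤ ∑ i, q i + α * (I.objective q ⬝ᵥ x) :=
        add_le_add_right ((hapx _ (I.objective_nonneg q)).2 x hx) _
    _ ≤ α * I.dualValue q x := by
        rw [dualValue, mul_add]
        exact add_le_add_left (le_mul_of_one_le_left hs hα) _
    _ ≤ α * (β * worstCost I.uncertainty x) := mul_le_mul_of_nonneg_left hqx (by linarith)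
    _ = α * β * robustOpt S I.uncertainty := by rw [hxopt, mul_assoc]

/-- A finite set of multipliers that contains a nearly optimal one for every `x`. -/
lemma exists_multipliers (hn : 1 ≤ n) (hm : 1 ≤ m) {ε : ℝ} (hε : 0 < ε) (hε1 : ε ≤ 1) :
    ∃ G : Finset (Vec m), (∀ p ∈ G, 0 ≤ p) ∧
      (∀ x : Vec n, IsBinary {x} →
        ∃ q ∈ G, I.dualValue q x ≤ (1 + 10 * ε) * worstCost I.uncertainty x) ∧
      (I.LDefined → (G.card : ℝ) ≤ 10 * callBound I ε ∧ 1 ≤ I.L ε) := by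
  have hn' : (1 : ℝ) ≤ n := by exact_mod_cast hn
  have hm' : (1 : ℝ) ≤ m := by exact_mod_cast hm
  obtain ⟨lo, r, hs, hL⟩ : ∃ lo r, I.Scale lo r ∧ (I.LDefined → (m + n) * r ≤ I.L ε) := by
    by_cases h : I.LDefined
    · obtain ⟨lo, r, hs, hr⟩ := I.exists_scale_le_L hn hε hε1 h
      exact ⟨lo, r, hs, fun _ => hr⟩
    · obtain ⟨lo, r, hs⟩ := I.exists_scale
      exact ⟨lo, r, hs, fun h' => absurd h' h⟩
  have hr := hs.one_le
  have hy : 2 ≤ (m + n) * r := by nlinarith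
  refine ⟨grid m ε lo (gridHeight ε ((m + n) * r)), fun p hp => grid_nonneg hε hs.lo_pos hp,
    fun x hx => ?_, fun h => ⟨card_grid_le_callBound I hm hε hε1 hy (hL h), ?_⟩⟩
  · obtain ⟨q, hq, hqx⟩ := I.exists_mem_grid_dualValue_le hm hε hε1 hs
      (le_pow_gridHeight hε (by linarith)) hx
    exact ⟨q, hq, hqx.trans
      (mul_le_mul_of_nonneg_right (by linarith) (I.worstCost_nonneg hx))⟩
  · linarith [hL h]

/-- The robust problem reduces to the nominal one. -/
lemma exists_apxAlg (hn : 1 ≤ n) (hm : 1 ≤ m) {ε : ℝ} (hε : 0 < ε) (hε1 : ε ≤ 1) :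
    ∃ P : ApxAlg n, ∀ (α : ℝ), 1 ≤ α → ∀ (S : Set (Vec n)), S.Nonempty → IsBinary S →
      ∀ (apx : Vec n → Vec n), IsApproxAlgorithm α S apx →
        IsDeterministicallyRobust (α * (1 + 10 * ε)) S I.uncertainty (P.result apx) ∧
        (I.LDefined → WithinCallBound 10 (fun m => 10 * (1 + 2 * m) ^ m) (fun m => 2 + 2 * m)
          I ε (P.calls apx)) := by
  obtain ⟨G, hG0, hG, hcard⟩ := I.exists_multipliers hn hm hε hε1
  refine ⟨I.search G.toList, fun α hα S hS hSb apx hapx =>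
    ⟨I.isDeterministicallyRobust_search hG0 hG hα hS hSb hapx, fun hL => ?_⟩⟩
  obtain ⟨h1, h2⟩ := hcard hL
  rw [calls_search, Finset.length_toList]
  refine ⟨h1, h1.trans ?_⟩
  have := callBound_le I hm hε hε1 h2
  push_cast
  linarith

end PolyData

theorem mainTheorem2 :
    ∃ (K : ℝ) (C p : ℕ → ℕ), 0 < K ∧
      ∀ (n m : ℕ), 1 ≤ n → 1 ≤ m →
        -- with an integrality gap verifier
        (∃ P : PolyData n m → ℝ → GapAlg n,
          ∀ (I : PolyData n m) (ε : ℝ), 0 < ε → ε ≤ 1 →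
          ∀ (α : ℝ), 1 ≤ α →
          ∀ (S Q : Set (Vec n)), S.Nonempty → IsBinary S → IsLPRelaxation S Q →
          ∀ (lp : Vec n → Vec n) (ver : Vec n → Vec n → Vec n),
            IsLPSolver Q lp → IsGapVerifier α S Q ver →
            IsDeterministicallyRobust (α * (1 + K * ε)) S I.uncertainty
              ((P I ε).result lp ver) ∧
            (I.LDefined →
              WithinCallBound K C p I ε ((P I ε).verifierCalls lp ver) ∧
              WithinCallBound K C p I ε ((P I ε).lpCalls lp ver))) ∧
        -- with an approximation algorithm for the nominal problem
        (∃ P : PolyData n m → ℝ → ApxAlg n,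
          ∀ (I : PolyData n m) (ε : ℝ), 0 < ε → ε ≤ 1 →
          ∀ (α : ℝ), 1 ≤ α →
          ∀ (S : Set (Vec n)), S.Nonempty → IsBinary S →
          ∀ (apx : Vec n → Vec n), IsApproxAlgorithm α S apx →
            IsDeterministicallyRobust (α * (1 + K * ε)) S I.uncertainty
              ((P I ε).result apx) ∧
            (I.LDefined → WithinCallBound K C p I ε ((P I ε).calls apx))) := by
  classical
  refine ⟨10, fun m => 10 * (1 + 2 * m) ^ m, fun m => 2 + 2 * m, by norm_num,
    fun n m hn hm => ?_⟩
  have h : ∀ (I : PolyData n m) (ε : ℝ), ∃ P : ApxAlg n, 0 < ε → ε ≤ 1 →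
      ∀ (α : ℝ), 1 ≤ α → ∀ (S : Set (Vec n)), S.Nonempty → IsBinary S →
      ∀ (apx : Vec n → Vec n), IsApproxAlgorithm α S apx →
        IsDeterministicallyRobust (α * (1 + 10 * ε)) S I.uncertainty (P.result apx) ∧
        (I.LDefined → WithinCallBound 10 (fun m => 10 * (1 + 2 * m) ^ m) (fun m => 2 + 2 * m)
          I ε (P.calls apx)) := by
    intro I ε
    by_cases hε : 0 < ε ∧ ε ≤ 1
    · obtain ⟨P, hP⟩ := I.exists_apxAlg hn hm hε.1 hε.2
      exact ⟨P, fun _ _ => hP⟩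
    -- Outside 0 < ε ≤ 1 nothing is required, so any algorithm serves.
    · exact ⟨.output 0, fun h0 h1 => absurd ⟨h0, h1⟩ hε⟩
  -- The algorithm is fixed from the data and ε alone, before α, S, Q and the oracles.
  choose P hP using h
  refine ⟨⟨fun I ε => (P I ε).toGapAlg, ?_⟩, ⟨P, hP⟩⟩
  intro I ε hε hε1 α hα S Q hS hSb hSQ lp ver hlp hver
  rw [ApxAlg.result_toGapAlg, ApxAlg.verifierCalls_toGapAlg, ApxAlg.lpCalls_toGapAlg]
  obtain ⟨h1, h2⟩ := hP I ε hε hε1 α hα S hS hSb _ (hver.isApproxAlgorithm hα hSQ.2 hlp)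
  exact ⟨h1, fun hL => ⟨h2 hL, h2 hL⟩⟩
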